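/- For real $p,q\ge 1$ let $w_{p,q}:\mathbb R\to\mathbb R$ be given by $$w_{p,q}(x)=\Big(\int_0^1 e^{-s^{-p}(1-s)^{-q}}\,ds\Big)^{-1}e^{-x^{-p}(1-x)^{-q}}\quad(0<x<1),\qquad w_{p,q}(x)=0\quad(x\notin(0,1)).$$ Let $\mathbb T^d=\mathbb R^d/\mathbb Z^d$ carry its Lebesgue probability measure. For a continuous $f:\mathbb T^d\to\mathbb C$, for $\rho,\theta\in\mathbb T^d$ and an integer $N\ge 2$ put $$\mathbf{Error}_N(\theta)=\Big|\frac1{A_N}\sum_{n=0}^{N-1}w_{p,q}(n/N)\,f(\theta+n\rho)-\int_{\mathbb T^d}f(x)\,dx\Big|,\qquad A_N=\sum_{n=0}^{N-1}w_{p,q}(n/N).$$ **Theorem.** There is a universal constant $c>0$ with the following property. Let $d\ge 1$, and let $f:\mathbb T^d\to\mathbb C$ be continuous and super-analytic, that is, for every $v>1$ its Fourier coefficients $\hat f_k=\int_{\mathbb T^d}f(x)e^{-2\pi i k\cdot x}\,dx$ satisfy $|\hat f_k|=\mathcal O\big(\exp(-|k|^v)\big)$ for $k\in\mathbb Z^d$,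 where $|k|=|k_1|+\dots+|k_d|$. Then for every $a\in(0,1)$ and for Lebesgue-almost every $\rho\in\mathbb T^d$, for all sufficiently large $p,q$ (that is, there is $P\ge 1$ such that for all real $p,q\ge P$), $$\mathbf{Error}_N(\theta)=\mathcal O\big(\exp(-c\,N^{a})\big)\qquad\text{uniformly in }\theta\in\mathbb T^d,$$ i.e. there is a constant $C$, independent of $N$ and $\theta$, such that $\mathbf{Error}_N(\theta)\le C\exp(-cN^a)$ for all $N\ge 2$ and all $\theta\in\mathbb T^d$. -/

import Mathlib

open MeasureTheory
open scoped BigOperators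

noncomputable section

/-- The unnormalised bump `exp (-x^(-p) (1-x)^(-q))`, only meaningful for `0 < x < 1`. -/
def bumpProfile (p q x : ℝ) : ℝ :=
  Real.exp (-(x ^ (-p) * (1 - x) ^ (-q)))

open Classical in
/-- The weight `w_{p,q}`: the normalised bump on `(0,1)`, extended by zero. -/
def expWeight (p q x : ℝ) : ℝ :=
  if x ∈ Set.Ioo (0 : ℝ) 1 then
    (∫ s in Set.Ioo (0 : ℝ) 1, bumpProfile p q s)⁻¹ * bumpProfile p q x
  else 0

/-- `A_N = ∑_{n<N} w_{p,q}(n/N)`; it is positive for `N ≥ 2` and zero for `N ≤ 1`. -/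
def weightSum (p q : ℝ) (N : ℕ) : ℝ :=
  ∑ n ∈ Finset.range N, expWeight p q ((n : ℝ) / (N : ℝ))

/-- The rotation `θ ↦ θ + ρ` of the torus `ℝ^d / ℤ^d`. -/
def torusRotation {d : ℕ} (ρ : UnitAddTorus (Fin d)) (θ : UnitAddTorus (Fin d)) :
    UnitAddTorus (Fin d) :=
  θ + ρ

/-- The weighted Birkhoff average `A_N⁻¹ ∑_{n<N} w_{p,q}(n/N) f(T_ρ^n θ)`. -/
def weightedBirkhoffAverage {d : ℕ} (p q : ℝ) (f : UnitAddTorus (Fin d) → ℂ)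
    (ρ θ : UnitAddTorus (Fin d)) (N : ℕ) : ℂ :=
  (weightSum p q N)⁻¹ •
    ∑ n ∈ Finset.range N, expWeight p q ((n : ℝ) / (N : ℝ)) • f ((torusRotation ρ)^[n] θ)

/-- The distance between the weighted Birkhoff average and the spatial average; `volume` is the
product of the length measures of total mass one on `ℝ/ℤ`. -/
def birkhoffError {d : ℕ} (p q : ℝ) (f : UnitAddTorus (Fin d) → ℂ)
    (ρ θ : UnitAddTorus (Fin d)) (N : ℕ) : ℝ :=
  ‖weightedBirkhoffAverage p q f ρ θ N - ∫ x, f x‖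

/-- The `ℓ¹` length `|k|` of a frequency vector `k ∈ ℤ^d`. -/
def freqNorm {d : ℕ} (k : Fin d → ℤ) : ℝ :=
  ∑ i, |(k i : ℝ)|

/-- Super-analyticity: `|f̂_k| = O(exp(-|k|^v))` for every `v > 1`. Since `v` is arbitrary, the
condition does not depend on the choice of the norm on `ℤ^d`. -/
def IsSuperAnalytic {d : ℕ} (f : UnitAddTorus (Fin d) → ℂ) : Prop :=
  ∀ v : ℝ, 1 < v → ∃ C : ℝ, ∀ k : Fin d → ℤ,
    ‖UnitAddTorus.mFourierCoeff f k‖ ≤ C * Real.exp (-(freqNorm k ^ v))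

end

/-!
Expanding `f` in its Fourier series, the error is at most the sum over `k ≠ 0` of `‖f̂_k‖` times the
normalised exponential sum `A_N⁻¹ ∑ w(n/N) zₖⁿ` with `zₖ = exp (2πi k·ρ)`
(`birkhoffError_le_tsum`). Three facts make this small.

* The bump is Gevrey of order `1 + 1/P` when `p, q ≥ P`. It extends holomorphically to discs of
  radius comparable to `x (1 - x)` around `x ∈ (0,1)` and still decays there, so Cauchy's estimate
  bounds its `m`-th derivative by `(K m^(1+1/P))^m` (`norm_bumpDeriv_le`); the extension by zero is
  smooth. Instead of Poisson summation, `m` summations by parts bound the exponential sum by a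
  multiple of `(N + m) (K m^(1+1/P) / (N ‖zₖ - 1‖))^m` (`exists_norm_weighted_sum_le`).
* By Borel-Cantelli almost every `ρ` satisfies `‖zₖ - 1‖ ≥ γ |k|^(-2d)` for all `k ≠ 0`
  (`ae_exists_diophantine`).
* By super-analyticity, the coefficients with `|k| ≥ N^ε` contribute `O(exp (-N))` however small
  `ε > 0` is (`IsSuperAnalytic.exists_coeff_le`).

For `|k| ≤ N^ε` take `m = ⌈N^a⌉`. With `P ≥ 2/(1-a)` and `2dε = (1-a)/4` the base of the `m`-th power
is at most a constant times `N^(-(1-a)/4)`, hence eventually at most `exp (-2)`, and the sum is at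
most `exp (-N^a)` (`exists_order_bound_le_exp`). As `a < 1` is arbitrary, the universal constant can
be taken to be `1`.
-/

/-! ### Gevrey bounds for the derivatives of the bump -/

/-- The holomorphic extension of the bump `x ↦ exp (-x^(-p) (1-x)^(-q))` from `(0,1)` to the
complex plane slit along `(-∞,0]` and `[1,∞)`; the powers are written through `Complex.log`. -/
noncomputable def complexBump (p q : ℝ) (z : ℂ) : ℂ :=
  Complex.exp (-Complex.exp (-(p * Complex.log z) - q * Complex.log (1 - z)))

lemma differentiableOn_complexBump (p q : ℝ) :
    DifferentiableOn ℂ (complexBump p q)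
      {z | z ∈ Complex.slitPlane ∧ 1 - z ∈ Complex.slitPlane} := by
  intro z hz
  unfold complexBump
  have h1 : DifferentiableAt ℂ (fun z : ℂ => Complex.log (1 - z)) z :=
    DifferentiableAt.clog (by fun_prop) hz.2
  have h2 : DifferentiableAt ℂ (fun z : ℂ => Complex.log z) z :=
    DifferentiableAt.clog (by fun_prop) hz.1
  apply DifferentiableAt.differentiableWithinAt
  fun_prop

lemma isOpen_complexBump_domain :
    IsOpen {z : ℂ | z ∈ Complex.slitPlane ∧ 1 - z ∈ Complex.slitPlane} :=
  Complex.isOpen_slitPlane.inter (Complex.isOpen_slitPlane.preimage (by fun_prop))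

lemma complexBump_ofReal (p q : ℝ) {x : ℝ} (h0 : 0 < x) (h1 : x < 1) :
    complexBump p q x = (bumpProfile p q x : ℂ) := by
  have h2 : 0 < 1 - x := by linarith
  unfold complexBump bumpProfile
  rw [Real.rpow_def_of_pos h0, Real.rpow_def_of_pos h2, ← Real.exp_add]
  have : (1 - x : ℂ) = ((1 - x : ℝ) : ℂ) := by push_cast; rfl
  rw [this, ← Complex.ofReal_log h0.le, ← Complex.ofReal_log h2.le]
  push_cast
  ring_nf

/-- On a disc around `x ∈ (0,1)` whose radius is a small multiple of `x (1 - x)`, the argument of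
`z^(-p) (1-z)^(-q)` stays small, so the complex bump decays like the real one. -/
lemma norm_complexBump_le {p q η x : ℝ} (hp : 0 ≤ p) (hq : 0 ≤ q) (hη : 0 < η) (hη2 : η ≤ 1 / 2)
    (hpq : (p + q) * η ≤ 1 / 6) (h0 : 0 < x) (h1 : x < 1) {z : ℂ}
    (hz : ‖z - x‖ ≤ η * (x * (1 - x))) :
    (z ∈ Complex.slitPlane ∧ 1 - z ∈ Complex.slitPlane) ∧
      ‖complexBump p q z‖ ≤ Real.exp (-(x ^ (-p) * (1 - x) ^ (-q) / 2)) := by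
  have h2 : 0 < 1 - x := by linarith
  set u : ℂ := (z - x) / x with hu
  set u' : ℂ := (x - z) / (1 - x : ℝ) with hu'
  have hxC : (x : ℂ) ≠ 0 := by exact_mod_cast h0.ne'
  have hxC' : ((1 - x : ℝ) : ℂ) ≠ 0 := by exact_mod_cast h2.ne'
  have hzu : z = x * (1 + u) := by rw [hu]; field_simp; ring
  have hzu' : 1 - z = (1 - x : ℝ) * (1 + u') := by
    rw [hu', mul_add, mul_div_cancel₀ _ hxC']; push_cast; ring
  have nu : ‖u‖ ≤ η := by
    rw [hu, norm_div, Complex.norm_real, Real.norm_of_nonneg h0.le, div_le_iff₀ h0]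
    nlinarith [mul_pos hη (mul_pos h0 h0)]
  have nu' : ‖u'‖ ≤ η := by
    rw [hu', norm_div, Complex.norm_real, Real.norm_of_nonneg h2.le, div_le_iff₀ h2, norm_sub_rev]
    nlinarith [mul_pos hη (mul_pos h2 h2)]
  have slit : ∀ v : ℂ, ‖v‖ ≤ η → 1 + v ∈ Complex.slitPlane := fun v hv =>
    Complex.mem_slitPlane_of_norm_lt_one (by linarith)
  have slit_mul : ∀ r : ℝ, 0 < r → ∀ v : ℂ, ‖v‖ ≤ η → (r : ℂ) * (1 + v) ∈ Complex.slitPlane := by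
    intro r hr v hv
    have hre : 0 < (1 + v).re := by
      have := (abs_le.1 ((Complex.abs_re_le_norm v).trans hv)).1
      simp only [Complex.add_re, Complex.one_re]; linarith
    left
    rw [Complex.re_ofReal_mul]
    positivity
  refine ⟨⟨hzu ▸ slit_mul x h0 u nu, hzu' ▸ slit_mul _ h2 u' nu'⟩, ?_⟩
  set L : ℂ := -(p * Complex.log (1 + u)) - q * Complex.log (1 + u') with hL
  have nL : ‖L‖ ≤ 1 / 4 := by
    have e1 := (Complex.norm_log_one_add_half_le_self (nu.trans hη2)).trans
      (mul_le_mul_of_nonneg_left nu (by norm_num))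
    have e2 := (Complex.norm_log_one_add_half_le_self (nu'.trans hη2)).trans
      (mul_le_mul_of_nonneg_left nu' (by norm_num))
    calc ‖L‖ ≤ ‖-((p : ℂ) * Complex.log (1 + u))‖ + ‖(q : ℂ) * Complex.log (1 + u')‖ :=
          norm_sub_le _ _
      _ = p * ‖Complex.log (1 + u)‖ + q * ‖Complex.log (1 + u')‖ := by
          rw [norm_neg, norm_mul, norm_mul, Complex.norm_real, Complex.norm_real,
            Real.norm_of_nonneg hp, Real.norm_of_nonneg hq]
      _ ≤ p * (3 / 2 * η) + q * (3 / 2 * η) := by gcongr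
      _ ≤ 1 / 4 := by linarith
  have hre : 1 / 2 ≤ (Complex.exp L).re := by
    have e1 := Complex.norm_exp_sub_one_le (x := L) (by linarith)
    have e2 := (abs_le.1 ((Complex.abs_re_le_norm _).trans e1)).1
    simp only [Complex.sub_re, Complex.one_re] at e2
    linarith
  have hexp : Complex.exp (-(p * Complex.log z) - q * Complex.log (1 - z)) =
      ((x ^ (-p) * (1 - x) ^ (-q) : ℝ) : ℂ) * Complex.exp L := by
    rw [hzu', hzu, Complex.log_ofReal_mul h0 (Complex.slitPlane_ne_zero (slit u nu)),
      Complex.log_ofReal_mul h2 (Complex.slitPlane_ne_zero (slit u' nu')),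
      Real.rpow_def_of_pos h0, Real.rpow_def_of_pos h2, ← Real.exp_add, Complex.ofReal_exp,
      ← Complex.exp_add, hL]
    push_cast
    ring_nf
  unfold complexBump
  rw [Complex.norm_exp, hexp, Complex.neg_re, Complex.re_ofReal_mul]
  apply Real.exp_le_exp.2
  have : 0 ≤ x ^ (-p) * (1 - x) ^ (-q) := by positivity
  nlinarith

/-- `exp (-t^(-P) / 2)` vanishes at `0` faster than every power, with the Gevrey constant
`m^(m/P)` in front of `t^m`. -/
lemma exp_neg_rpow_le {P t : ℝ} (hP : 2 ≤ P) (ht : 0 < t) (m : ℕ) :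
    Real.exp (-(t ^ (-P) / 2)) ≤ ((m : ℝ) ^ (1 / P) * t) ^ m := by
  rcases Nat.eq_zero_or_pos m with rfl | hm
  · simp only [pow_zero, Real.exp_le_one_iff]
    have : 0 ≤ t ^ (-P) := by positivity
    linarith
  have hm' : (0 : ℝ) < m := by exact_mod_cast hm
  set s : ℝ := (m : ℝ) ^ (1 / P) * t with hs
  have hs0 : 0 < s := by positivity
  have hsP : s ^ (-P) = t ^ (-P) / m := by
    rw [hs, Real.mul_rpow (by positivity) ht.le, ← Real.rpow_mul hm'.le]
    have : 1 / P * -P = -1 := by field_simp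
    rw [this, Real.rpow_neg_one]
    field_simp
  have h1 : -P * Real.log s ≤ t ^ (-P) / m := by
    rw [← Real.log_rpow hs0, ← hsP]
    linarith [Real.log_le_sub_one_of_pos (Real.rpow_pos_of_pos hs0 (-P))]
  have h2 : -(P * (m * Real.log s)) ≤ t ^ (-P) := by
    rw [le_div_iff₀ hm'] at h1
    linarith
  have h0 : 0 < t ^ (-P) := by positivity
  have h3 : -(t ^ (-P) / 2) ≤ m * Real.log s := by
    by_contra hc
    push Not at hc
    nlinarith
  calc Real.exp (-(t ^ (-P) / 2)) ≤ Real.exp (m * Real.log s) := Real.exp_le_exp.2 h3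
    _ = s ^ m := by rw [Real.exp_nat_mul, Real.exp_log hs0]

lemma rpow_neg_mul_le {P p q x : ℝ} (hp : P ≤ p) (hq : P ≤ q) (h0 : 0 < x) (h1 : x < 1) :
    (x * (1 - x)) ^ (-P) ≤ x ^ (-p) * (1 - x) ^ (-q) := by
  have h2 : 0 < 1 - x := by linarith
  rw [Real.mul_rpow h0.le h2.le]
  have e1 := Real.rpow_le_rpow_of_exponent_ge h0 h1.le (neg_le_neg hp)
  have e2 := Real.rpow_le_rpow_of_exponent_ge h2 (by linarith) (neg_le_neg hq)
  gcongr

/-- Cauchy's estimate on the circle of radius `η x (1 - x)` around `x`. -/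
lemma norm_iteratedDeriv_complexBump_le {P p q η x : ℝ} (hP : 2 ≤ P) (hp : P ≤ p) (hq : P ≤ q)
    (hη : 0 < η) (hη2 : η ≤ 1 / 2) (hpq : (p + q) * η ≤ 1 / 6) (h0 : 0 < x) (h1 : x < 1) (m : ℕ) :
    ‖iteratedDeriv m (complexBump p q) x‖ ≤
      m.factorial * Real.exp (-((x * (1 - x)) ^ (-P) / 2)) / (η * (x * (1 - x))) ^ m := by
  have h2 : 0 < 1 - x := by linarith
  have key : ∀ z : ℂ, ‖z - x‖ ≤ η * (x * (1 - x)) → _ := fun z hz =>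
    norm_complexBump_le (p := p) (q := q) (by linarith) (by linarith) hη hη2 hpq h0 h1 hz
  apply Complex.norm_iteratedDeriv_le_of_forall_mem_sphere_norm_le m (by positivity)
  · apply DifferentiableOn.diffContOnCl
    refine (differentiableOn_complexBump p q).mono fun z hz => ?_
    rw [closure_ball _ (by positivity)] at hz
    exact (key z (by simpa [dist_eq_norm] using hz)).1
  · intro z hz
    refine (key z (by simpa [dist_eq_norm] using hz.le)).2.trans (Real.exp_le_exp.2 ?_)
    linarith [rpow_neg_mul_le hp hq h0 h1]

/-- The `m`-th derivative of the bump `exp (-x^(-p) (1-x)^(-q))` extended by zero to `ℝ`: the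
complex derivative on `(0,1)` and zero elsewhere. -/
noncomputable def bumpDeriv (p q : ℝ) (m : ℕ) (x : ℝ) : ℂ :=
  if 0 < x ∧ x < 1 then iteratedDeriv m (complexBump p q) x else 0

lemma bumpDeriv_zero (p q x : ℝ) :
    bumpDeriv p q 0 x = if 0 < x ∧ x < 1 then (bumpProfile p q x : ℂ) else 0 := by
  unfold bumpDeriv
  split_ifs with h
  · rw [iteratedDeriv_zero, complexBump_ofReal p q h.1 h.2]
  · rfl

/-- The Gevrey bound of order `1 + 1/P` for the derivatives of the bump. -/
lemma norm_bumpDeriv_le {P p q η : ℝ} (hP : 2 ≤ P) (hp : P ≤ p) (hq : P ≤ q)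
    (hη : 0 < η) (hη2 : η ≤ 1 / 2) (hpq : (p + q) * η ≤ 1 / 6) (m : ℕ) (x : ℝ) :
    ‖bumpDeriv p q m x‖ ≤ ((m : ℝ) ^ (1 + 1 / P) / η) ^ m := by
  unfold bumpDeriv
  split_ifs with h
  · have h2 : 0 < 1 - x := by linarith [h.2]
    have ht : 0 < x * (1 - x) := mul_pos h.1 h2
    refine (norm_iteratedDeriv_complexBump_le hP hp hq hη hη2 hpq h.1 h.2 m).trans ?_
    rw [div_le_iff₀ (by positivity), ← mul_pow]
    have e1 : ((m : ℝ) ^ (1 + 1 / P) / η * (η * (x * (1 - x)))) ^ m =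
        (m : ℝ) ^ m * ((m : ℝ) ^ (1 / P) * (x * (1 - x))) ^ m := by
      rw [← mul_pow, Real.rpow_one_add' (by positivity) (by positivity)]
      field_simp
    rw [e1]
    have e2 : (m.factorial : ℝ) ≤ (m : ℝ) ^ m := by exact_mod_cast Nat.factorial_le_pow m
    have := exp_neg_rpow_le hP ht m
    gcongr
  · simp only [norm_zero]
    positivity

/-- Quadratic vanishing at the endpoints, which is what makes the extension by zero differentiable
there; it comes from using `exp_neg_rpow_le` with exponent `m + 2` instead of `m`. -/
lemma norm_bumpDeriv_le_sq {P p q η : ℝ} (hP : 2 ≤ P) (hp : P ≤ p) (hq : P ≤ q)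
    (hη : 0 < η) (hη2 : η ≤ 1 / 2) (hpq : (p + q) * η ≤ 1 / 6) (m : ℕ) :
    ∃ C : ℝ, 0 ≤ C ∧ ∀ x, 0 < x → x < 1 → ‖bumpDeriv p q m x‖ ≤ C * (x * (1 - x)) ^ 2 := by
  refine ⟨m.factorial * (((m + 2 : ℕ) : ℝ) ^ (1 / P)) ^ (m + 2) / η ^ m, by positivity,
    fun x h0 h1 => ?_⟩
  have h2 : 0 < 1 - x := by linarith
  have ht : 0 < x * (1 - x) := mul_pos h0 h2
  rw [bumpDeriv, if_pos ⟨h0, h1⟩]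
  refine (norm_iteratedDeriv_complexBump_le hP hp hq hη hη2 hpq h0 h1 m).trans ?_
  have := exp_neg_rpow_le hP ht (m + 2)
  rw [mul_pow] at this
  rw [div_le_iff₀ (by positivity)]
  calc _ ≤ (m.factorial : ℝ) *
        ((((m + 2 : ℕ) : ℝ) ^ (1 / P)) ^ (m + 2) * (x * (1 - x)) ^ (m + 2)) := by gcongr
    _ = _ := by
      rw [mul_pow η]
      field_simp
      ring

/-- The functions `bumpDeriv p q m` are successive derivatives on all of `ℝ`, endpoints included, so
the zero-extended bump is smooth. -/
lemma hasDerivAt_bumpDeriv {P p q : ℝ} (hP : 2 ≤ P) (hp : P ≤ p) (hq : P ≤ q) (m : ℕ) (x : ℝ) :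
    HasDerivAt (bumpDeriv p q m) (bumpDeriv p q (m + 1) x) x := by
  by_cases h : 0 < x ∧ x < 1
  · have hmem : (x : ℂ) ∈ {z : ℂ | z ∈ Complex.slitPlane ∧ 1 - z ∈ Complex.slitPlane} := by
      refine ⟨by simpa using h.1, ?_⟩
      left
      simpa using h.2
    have hd : DifferentiableAt ℂ (iteratedDeriv m (complexBump p q)) x := by
      have := (differentiableOn_complexBump p q).analyticAt
        (isOpen_complexBump_domain.mem_nhds hmem)
      rw [iteratedDeriv_eq_iterate]
      exact (this.iterated_deriv m).differentiableAt
    have h1 : HasDerivAt (fun y : ℝ => iteratedDeriv m (complexBump p q) y)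
        (iteratedDeriv (m + 1) (complexBump p q) x) x := by
      rw [iteratedDeriv_succ]
      exact hd.hasDerivAt.comp_ofReal
    rw [bumpDeriv, if_pos h]
    refine h1.congr_of_eventuallyEq ?_
    filter_upwards [Ioo_mem_nhds h.1 h.2] with y hy
    rw [bumpDeriv, if_pos ⟨hy.1, hy.2⟩]
  · -- For `x` outside `(0,1)` the product `y (1 - y)` is at most `|y - x|`, so the quadratic bound
    -- on `(0,1)` gives derivative zero at `x`.
    set η : ℝ := 1 / (6 * (p + q)) with hη
    have hpq : 4 ≤ p + q := by linarith
    obtain ⟨C, hC, hb⟩ := norm_bumpDeriv_le_sq (η := η) hP hp hq (by positivity)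
      (by rw [hη]; gcongr; linarith) (by rw [hη]; field_simp; rfl) m
    have hx : bumpDeriv p q m x = 0 := if_neg h
    rw [bumpDeriv, if_neg h, hasDerivAt_iff_isLittleO]
    simp only [hx, smul_zero, sub_zero]
    refine Asymptotics.IsBigO.trans_isLittleO (g := fun y => (y - x) ^ 2) ?_ ?_
    · refine Asymptotics.IsBigO.of_bound C (Filter.Eventually.of_forall fun y => ?_)
      by_cases hy : 0 < y ∧ y < 1
      · refine (hb y hy.1 hy.2).trans ?_
        have h2 : 0 < 1 - y := by linarith [hy.2]
        rw [Real.norm_of_nonneg (sq_nonneg _), ← sq_abs (y - x)]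
        have : y * (1 - y) ≤ |y - x| := by
          rcases le_or_gt x 0 with hx0 | hx0
          · refine le_trans ?_ (le_abs_self _)
            nlinarith [hy.1]
          · have hx1 : 1 ≤ x := by
              by_contra hc
              exact h ⟨hx0, not_le.1 hc⟩
            refine le_trans ?_ (neg_le_abs _)
            nlinarith [hy.1]
        have h3 : 0 ≤ y * (1 - y) := (mul_pos hy.1 h2).le
        gcongr
      · rw [bumpDeriv, if_neg hy, norm_zero]
        positivity
    · simpa using Asymptotics.isLittleO_pow_sub_sub x (one_lt_two)

/-! ### Finite differences and summation by parts -/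

/-- Iterated finite differences are controlled by the derivative of the same order. -/
lemma norm_fwdDiff_iter_le {g : ℕ → ℝ → ℂ} (hg : ∀ m x, HasDerivAt (g m) (g (m + 1) x) x)
    {h : ℝ} (hh : 0 ≤ h) {D : ℝ} (m : ℕ) :
    ∀ j : ℕ, (∀ x, ‖g (j + m) x‖ ≤ D) → ∀ x, ‖(fwdDiff h)^[m] (g j) x‖ ≤ h ^ m * D := by
  have hderiv : ∀ m j x,
      HasDerivAt ((fwdDiff h)^[m] (g j)) ((fwdDiff h)^[m] (g (j + 1)) x) x := by
    intro m
    induction m with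
    | zero => exact fun j x => hg j x
    | succ m ih =>
      intro j x
      simp only [Function.iterate_succ_apply']
      exact ((ih j (x + h)).comp_add_const x h).sub (ih j x)
  induction m with
  | zero => intro j hD x; simpa using hD x
  | succ m ih =>
    intro j hD x
    have hD' : ∀ x, ‖g (j + 1 + m) x‖ ≤ D := by
      intro x
      have := hD x
      rwa [show j + (m + 1) = j + 1 + m by ring] at this
    have := Convex.norm_image_sub_le_of_norm_hasDerivWithin_le (𝕜 := ℝ) (s := Set.univ)
      (fun y _ => (hderiv m j y).hasDerivWithinAt) (fun y _ => ih (j + 1) hD' y) convex_univ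
      (Set.mem_univ x) (Set.mem_univ (x + h))
    rw [Function.iterate_succ_apply', fwdDiff]
    refine this.trans (le_of_eq ?_)
    rw [add_sub_cancel_left, Real.norm_of_nonneg hh]
    ring

lemma fwdDiff_iter_eq_zero_of_notMem_Ico {u : ℤ → ℂ} {a b : ℤ}
    (hu : ∀ n, n ∉ Finset.Ico a b → u n = 0) (m : ℕ) :
    ∀ n, n ∉ Finset.Ico (a - m) b → (fwdDiff 1)^[m] u n = 0 := by
  induction m with
  | zero => simpa using hu
  | succ m ih =>
    intro n hn
    rw [Function.iterate_succ_apply', fwdDiff]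
    simp only [Finset.mem_Ico, not_and, not_lt] at hn ih
    push_cast at hn
    rw [ih (n + 1) (fun h => by have := hn (by linarith); linarith),
      ih n (fun h => hn (by linarith)), sub_zero]

/-- Summation by parts for finitely supported sequences on `ℤ`: a difference in the coefficients
becomes a factor `z⁻¹ - 1`. -/
lemma tsum_fwdDiff_mul_zpow {u : ℤ → ℂ} {a b : ℤ} (hu : ∀ n, n ∉ Finset.Ico a b → u n = 0)
    {z : ℂ} (hz : z ≠ 0) (m : ℕ) :
    ∑' n : ℤ, (fwdDiff 1)^[m] u n * z ^ n = (z⁻¹ - 1) ^ m * ∑' n : ℤ, u n * z ^ n := by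
  induction m with
  | zero => simp
  | succ m ih =>
    set v := (fwdDiff (1 : ℤ))^[m] u with hv
    have hsum : Summable fun n : ℤ => v n * z ^ n := by
      refine summable_of_ne_finset_zero (s := Finset.Ico (a - m) b) fun n hn => ?_
      rw [hv, fwdDiff_iter_eq_zero_of_notMem_Ico hu m n hn, zero_mul]
    have hshift : Summable fun n : ℤ => v (n + 1) * z ^ (n + 1) := by
      have := (Equiv.addRight (1 : ℤ)).summable_iff (f := fun n : ℤ => v n * z ^ n)
      simp only [Function.comp_def, Equiv.coe_addRight] at this
      exact this.2 hsum
    have hterm : ∀ n : ℤ, (fwdDiff 1)^[m + 1] u n * z ^ n =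
        z⁻¹ * (v (n + 1) * z ^ (n + 1)) - v n * z ^ n := by
      intro n
      rw [Function.iterate_succ_apply', fwdDiff, ← hv, zpow_add_one₀ hz]
      field_simp
    have htsum : ∑' n : ℤ, v (n + 1) * z ^ (n + 1) = ∑' n : ℤ, v n * z ^ n :=
      (Equiv.addRight (1 : ℤ)).tsum_eq (fun n : ℤ => v n * z ^ n)
    rw [tsum_congr hterm, (hshift.mul_left _).tsum_sub hsum, tsum_mul_left, htsum, ih, pow_succ]
    ring

/-- Exponential sums with smooth weights: `m` summations by parts gain `m` factors
`1 / (N ‖z - 1‖)` at the price of the `m`-th derivative of the weight. -/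
lemma norm_sum_mul_pow_le {g : ℕ → ℝ → ℂ} (hg : ∀ m x, HasDerivAt (g m) (g (m + 1) x) x)
    (hsupp : ∀ x, ¬(0 < x ∧ x < 1) → g 0 x = 0) {N : ℕ} (hN : 0 < N) {m : ℕ} {D : ℝ}
    (hD : ∀ x, ‖g m x‖ ≤ D) {z : ℂ} (hz : ‖z‖ = 1) (hz1 : z ≠ 1) :
    ‖∑ n ∈ Finset.range N, g 0 ((n : ℝ) / N) * z ^ n‖ ≤
      (N + m) * (D / (N * ‖z - 1‖) ^ m) := by
  have hz0 : z ≠ 0 := by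
    rintro rfl
    simp at hz
  have hN' : (0 : ℝ) < N := by exact_mod_cast hN
  -- As a sequence on `ℤ` the weight is supported in `[0, N)`, so its `m`-th difference has at most
  -- `N + m` nonzero terms.
  set u : ℤ → ℂ := fun n => g 0 ((n : ℝ) / N) with hu
  have hu0 : ∀ n, n ∉ Finset.Ico (0 : ℤ) N → u n = 0 := by
    intro n hn
    apply hsupp
    rintro ⟨h1, h2⟩
    apply hn
    rw [div_lt_one hN'] at h2
    have h3 : (0 : ℝ) < n := by
      by_contra hc
      exact absurd h1 (not_lt.2 (div_nonpos_of_nonpos_of_nonneg (not_lt.1 hc) hN'.le))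
    rw [Finset.mem_Ico]
    exact ⟨by exact_mod_cast h3.le, by exact_mod_cast h2⟩
  have hsum : ∑' n : ℤ, u n * z ^ n = ∑ n ∈ Finset.range N, g 0 ((n : ℝ) / N) * z ^ n := by
    rw [tsum_eq_sum (s := (Finset.range N).map Nat.castEmbedding), Finset.sum_map]
    · simp [hu]
    · intro n hn
      rw [hu0 n, zero_mul]
      intro hn'
      rw [Finset.mem_Ico] at hn'
      apply hn
      rw [Finset.mem_map]
      refine ⟨n.toNat, Finset.mem_range.2 (by omega), ?_⟩
      simp only [Nat.castEmbedding_apply]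
      omega
  have hdiff : ∀ m : ℕ, ∀ n : ℤ,
      (fwdDiff 1)^[m] u n = (fwdDiff (1 / (N : ℝ)))^[m] (g 0) ((n : ℝ) / N) := by
    intro m
    induction m with
    | zero => intro n; rfl
    | succ m ih =>
      intro n
      rw [Function.iterate_succ_apply', Function.iterate_succ_apply', fwdDiff, fwdDiff, ih, ih]
      push_cast
      rw [add_div]
  have hbound : ‖∑' n : ℤ, (fwdDiff 1)^[m] u n * z ^ n‖ ≤ (N + m) * ((1 / (N : ℝ)) ^ m * D) := by
    rw [tsum_eq_sum (s := Finset.Ico ((0 : ℤ) - m) N) fun n hn => by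
        rw [fwdDiff_iter_eq_zero_of_notMem_Ico hu0 m n hn, zero_mul]]
    refine (norm_sum_le_of_le (f := fun n : ℤ => (fwdDiff 1)^[m] u n * z ^ n) _
      (n := fun _ => (1 / (N : ℝ)) ^ m * D) fun n _ => ?_).trans (le_of_eq ?_)
    · rw [norm_mul, norm_zpow, hz, one_zpow, mul_one, hdiff]
      exact norm_fwdDiff_iter_le hg (by positivity) m 0 (by simpa using hD) _
    · rw [Finset.sum_const, nsmul_eq_mul, Int.card_Ico, zero_sub, sub_neg_eq_add]
      congr 1
      exact_mod_cast Int.toNat_natCast (N + m)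
  rw [tsum_fwdDiff_mul_zpow hu0 hz0, norm_mul, norm_pow, hsum] at hbound
  have hzn : ‖z⁻¹ - 1‖ = ‖z - 1‖ := by
    have : z⁻¹ - 1 = -(z⁻¹ * (z - 1)) := by field_simp; ring
    rw [this, norm_neg, norm_mul, norm_inv, hz, inv_one, one_mul]
  rw [hzn] at hbound
  have hz1' : 0 < ‖z - 1‖ := norm_pos_iff.2 (sub_ne_zero.2 hz1)
  rw [← mul_div_assoc, le_div_iff₀ (by positivity), mul_pow]
  calc _ = (N : ℝ) ^ m * (‖z - 1‖ ^ m *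
        ‖∑ n ∈ Finset.range N, g 0 ((n : ℝ) / N) * z ^ n‖) := by ring
    _ ≤ (N : ℝ) ^ m * ((N + m) * ((1 / (N : ℝ)) ^ m * D)) := by gcongr
    _ = _ := by
      rw [one_div, inv_pow]
      field_simp

/-! ### Exponential sums against the weight -/

lemma expWeight_nonneg (p q x : ℝ) : 0 ≤ expWeight p q x := by
  unfold expWeight
  split_ifs
  · exact mul_nonneg (inv_nonneg.2 (integral_nonneg fun s => (Real.exp_pos _).le))
      (Real.exp_pos _).le
  · exact le_rfl

lemma integral_bumpProfile_pos {p q : ℝ} :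
    0 < ∫ s in Set.Ioo (0 : ℝ) 1, bumpProfile p q s := by
  have hint : IntegrableOn (bumpProfile p q) (Set.Ioo 0 1) := by
    have hmeas0 : Measurable (bumpProfile p q) := by
      unfold bumpProfile
      fun_prop
    have hmeas := hmeas0.aestronglyMeasurable (μ := volume)
    refine Measure.integrableOn_of_bounded (M := 1) (by simp)
      hmeas ?_
    filter_upwards [ae_restrict_mem measurableSet_Ioo] with x hx
    have h2 : 0 < 1 - x := by linarith [hx.2]
    have h1 : 0 < x := hx.1
    rw [bumpProfile, Real.norm_of_nonneg (Real.exp_pos _).le, Real.exp_le_one_iff]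
    have : 0 ≤ x ^ (-p) * (1 - x) ^ (-q) := by positivity
    linarith
  rw [setIntegral_pos_iff_support_of_nonneg_ae (f := bumpProfile p q)
    (Filter.Eventually.of_forall fun x => (Real.exp_pos _).le) hint]
  have : Function.support (bumpProfile p q) = Set.univ := by
    ext x
    simp [bumpProfile, Real.exp_ne_zero]
  rw [this, Set.univ_inter, Real.volume_Ioo]
  simp

/-- The normalisations `A_N` are bounded below uniformly in `N ≥ 2`, by the term of index
`⌊N/2⌋`. -/
lemma exists_weightSum_ge {p q : ℝ} (hp : 0 ≤ p) (hq : 0 ≤ q) :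
    ∃ c : ℝ, 0 < c ∧ ∀ N : ℕ, 2 ≤ N → c ≤ weightSum p q N := by
  have hI := integral_bumpProfile_pos (p := p) (q := q)
  refine ⟨(∫ s in Set.Ioo (0 : ℝ) 1, bumpProfile p q s)⁻¹ *
    Real.exp (-((1 / 3 : ℝ) ^ (-p) * (1 / 2 : ℝ) ^ (-q))), by positivity, fun N hN => ?_⟩
  have hN' : (0 : ℝ) < N := by exact_mod_cast (by omega : 0 < N)
  have h1 : (1 / 3 : ℝ) ≤ ((N / 2 : ℕ) : ℝ) / N := by
    rw [le_div_iff₀ hN']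
    have : (N : ℝ) ≤ 3 * ((N / 2 : ℕ) : ℝ) := by exact_mod_cast (by omega : N ≤ 3 * (N / 2))
    linarith
  have h2 : ((N / 2 : ℕ) : ℝ) / N ≤ 1 / 2 := by
    rw [div_le_iff₀ hN']
    have : 2 * ((N / 2 : ℕ) : ℝ) ≤ N := by exact_mod_cast (by omega : 2 * (N / 2) ≤ N)
    linarith
  refine le_trans ?_ (Finset.single_le_sum (f := fun n : ℕ => expWeight p q ((n : ℝ) / N))
    (fun n _ => expWeight_nonneg p q _) (Finset.mem_range.2 (by omega : N / 2 < N)))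
  set x := ((N / 2 : ℕ) : ℝ) / N
  have hx : x ∈ Set.Ioo (0 : ℝ) 1 := ⟨by linarith, by linarith⟩
  have hx0 : 0 < 1 - x := by linarith [hx.2]
  rw [expWeight, if_pos hx, bumpProfile]
  have e1 : x ^ (-p) ≤ (1 / 3 : ℝ) ^ (-p) :=
    Real.rpow_le_rpow_of_nonpos (by norm_num) h1 (by linarith)
  have e2 : (1 - x) ^ (-q) ≤ (1 / 2 : ℝ) ^ (-q) :=
    Real.rpow_le_rpow_of_nonpos (by norm_num) (by linarith) (by linarith)
  gcongr

/-- Exponential sums against the weight `w_{p,q}`, normalised by `A_N`: the quantitative decay that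
drives the theorem. The order `m` of the summation by parts is free. -/
lemma exists_norm_weighted_sum_le {P p q : ℝ} (hP : 2 ≤ P) (hp : P ≤ p) (hq : P ≤ q) :
    ∃ B K : ℝ, 0 < B ∧ 0 < K ∧ ∀ N : ℕ, 2 ≤ N → ∀ m : ℕ, ∀ z : ℂ, ‖z‖ = 1 → z ≠ 1 →
      ‖((weightSum p q N)⁻¹ : ℂ) *
          ∑ n ∈ Finset.range N, (expWeight p q ((n : ℝ) / N) : ℂ) * z ^ n‖ ≤
        B * (N + m) * (K * (m : ℝ) ^ (1 + 1 / P) / (N * ‖z - 1‖)) ^ m := by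
  obtain ⟨c, hc, hA⟩ := exists_weightSum_ge (p := p) (q := q) (by linarith) (by linarith)
  set I := ∫ s in Set.Ioo (0 : ℝ) 1, bumpProfile p q s with hI
  have hI0 : 0 < I := integral_bumpProfile_pos
  set η : ℝ := 1 / (6 * (p + q)) with hη
  have hpq : 4 ≤ p + q := by linarith
  have hη0 : 0 < η := by positivity
  have hη2 : η ≤ 1 / 2 := by rw [hη]; gcongr; linarith
  have hpqη : (p + q) * η ≤ 1 / 6 := by rw [hη]; field_simp; rfl
  refine ⟨c⁻¹ * I⁻¹, η⁻¹, by positivity, by positivity, fun N hN m z hz hz1 => ?_⟩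
  have key := norm_sum_mul_pow_le (hasDerivAt_bumpDeriv hP hp hq)
    (fun x hx => if_neg hx) (by omega : 0 < N)
    (norm_bumpDeriv_le hP hp hq hη0 hη2 hpqη m) hz hz1
  have hw : ∀ x : ℝ, (expWeight p q x : ℂ) = (I : ℂ)⁻¹ * bumpDeriv p q 0 x := by
    intro x
    rw [bumpDeriv_zero, expWeight]
    by_cases hx : 0 < x ∧ x < 1
    · rw [if_pos hx, if_pos (show x ∈ Set.Ioo (0 : ℝ) 1 from hx)]
      push_cast
      rfl
    · rw [if_neg hx, if_neg (show x ∉ Set.Ioo (0 : ℝ) 1 from hx)]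
      simp
  simp only [hw, mul_assoc]
  rw [← Finset.mul_sum, norm_mul, norm_mul, norm_inv, norm_inv, Complex.norm_real,
    Complex.norm_real, Real.norm_of_nonneg hI0.le, Real.norm_of_nonneg (hc.le.trans (hA N hN))]
  have hAc : (weightSum p q N)⁻¹ ≤ c⁻¹ := inv_anti₀ hc (hA N hN)
  rw [← div_pow] at key
  calc _ ≤ c⁻¹ * (I⁻¹ *
        ((N + m) * ((m : ℝ) ^ (1 + 1 / P) / η / (N * ‖z - 1‖)) ^ m)) := by gcongr
    _ = _ := by
      rw [div_eq_inv_mul _ η]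

/-- The trivial bound: a weighted average of points of the unit circle has modulus at most one. -/
lemma norm_weighted_sum_le_one (p q : ℝ) (N : ℕ) {z : ℂ} (hz : ‖z‖ = 1) :
    ‖((weightSum p q N)⁻¹ : ℂ) *
      ∑ n ∈ Finset.range N, (expWeight p q ((n : ℝ) / N) : ℂ) * z ^ n‖ ≤ 1 := by
  have hA : 0 ≤ weightSum p q N := Finset.sum_nonneg fun n _ => expWeight_nonneg p q _
  rw [norm_mul, norm_inv, Complex.norm_real, Real.norm_of_nonneg hA]
  have : ‖∑ n ∈ Finset.range N, (expWeight p q ((n : ℝ) / N) : ℂ) * z ^ n‖ ≤ weightSum p q N := by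
    refine norm_sum_le_of_le _ fun n _ => ?_
    rw [norm_mul, norm_pow, hz, one_pow, mul_one, Complex.norm_real,
      Real.norm_of_nonneg (expWeight_nonneg p q _)]
  exact (mul_le_mul_of_nonneg_left this (inv_nonneg.2 hA)).trans (inv_mul_le_one)

/-! ### Summation over the frequency lattice -/

lemma abs_le_freqNorm {d : ℕ} (k : Fin d → ℤ) (i : Fin d) : |(k i : ℝ)| ≤ freqNorm k :=
  Finset.single_le_sum (f := fun i => |(k i : ℝ)|) (fun _ _ => abs_nonneg _) (Finset.mem_univ i)

lemma one_le_freqNorm {d : ℕ} {k : Fin d → ℤ} (hk : k ≠ 0) : 1 ≤ freqNorm k := by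
  obtain ⟨i, hi⟩ := Function.ne_iff.1 hk
  exact le_trans (by exact_mod_cast Int.one_le_abs hi) (abs_le_freqNorm k i)

lemma freqNorm_nonneg {d : ℕ} (k : Fin d → ℤ) : 0 ≤ freqNorm k :=
  Finset.sum_nonneg fun _ _ => abs_nonneg _

/-- Products of a summable family over finitely many independent indices are summable. -/
lemma summable_prod_apply {ι κ : Type*} [Fintype ι] {g : κ → ℝ} (hg : Summable g)
    (h0 : ∀ n, 0 ≤ g n) : Summable fun k : ι → κ => ∏ i, g (k i) := by
  classical
  refine summable_of_sum_le (c := ∏ _i : ι, ∑' n, g n)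
    (fun k => Finset.prod_nonneg fun i _ => h0 _) fun s => ?_
  calc ∑ k ∈ s, ∏ i, g (k i)
      ≤ ∑ k ∈ Fintype.piFinset (fun i => s.image fun k => k i), ∏ i, g (k i) := by
        refine Finset.sum_le_sum_of_subset_of_nonneg (fun k hk => ?_)
          fun k _ _ => Finset.prod_nonneg fun i _ => h0 _
        exact Fintype.mem_piFinset.2 fun i => Finset.mem_image_of_mem _ hk
    _ = ∏ i, ∑ n ∈ s.image (fun k => k i), g n := (Finset.prod_univ_sum _ _).symm
    _ ≤ ∏ _i : ι, ∑' n, g n := Finset.prod_le_prod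
        (fun i _ => Finset.sum_nonneg fun n _ => h0 n)
        fun i _ => hg.sum_le_tsum _ fun n _ => h0 n

lemma summable_exp_neg_freqNorm (d : ℕ) :
    Summable fun k : Fin d → ℤ => Real.exp (-freqNorm k) := by
  have h : Summable fun n : ℤ => Real.exp (-|(n : ℝ)|) := by
    apply Summable.of_nat_of_neg <;> simpa using Real.summable_exp_neg_nat
  refine (summable_prod_apply (ι := Fin d) h fun n => (Real.exp_pos _).le).congr fun k => ?_
  rw [← Real.exp_sum, Finset.sum_neg_distrib]
  rfl

/-- The tolerance in the Diophantine condition: it is summable over `ℤ^d` and bounded below by a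
power of the `ℓ¹` length. -/
noncomputable def smallDivisorBound {d : ℕ} (k : Fin d → ℤ) : ℝ :=
  ∏ i, ((1 + |(k i : ℝ)|) ^ 2)⁻¹

lemma summable_smallDivisorBound (d : ℕ) :
    Summable (smallDivisorBound : (Fin d → ℤ) → ℝ) := by
  have h0 : Summable fun n : ℕ => ((1 + (n : ℝ)) ^ 2)⁻¹ := by
    have := (summable_nat_add_iff 1).2 (Real.summable_nat_pow_inv.2 one_lt_two)
    simpa [add_comm] using this
  have h : Summable fun n : ℤ => ((1 + |(n : ℝ)|) ^ 2)⁻¹ := by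
    apply Summable.of_nat_of_neg <;> simpa using h0
  exact (summable_prod_apply (ι := Fin d) h fun n => by positivity).congr fun k => by
    rw [smallDivisorBound]

lemma le_smallDivisorBound {d : ℕ} {k : Fin d → ℤ} (hk : k ≠ 0) :
    ((2 * freqNorm k) ^ (2 * d))⁻¹ ≤ smallDivisorBound k := by
  have h1 := one_le_freqNorm hk
  calc ((2 * freqNorm k) ^ (2 * d))⁻¹ = ∏ _i : Fin d, ((2 * freqNorm k) ^ 2)⁻¹ := by
        rw [Finset.prod_const, Finset.card_univ, Fintype.card_fin, pow_mul, inv_pow]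
    _ ≤ smallDivisorBound k := by
        refine Finset.prod_le_prod (fun i _ => by positivity) fun i _ => ?_
        have := abs_le_freqNorm k i
        gcongr
        linarith

/-! ### Diophantine rotation vectors -/

/-- The chord dominates the arc: on the circle `|2 sin (π t)| ≥ 4 |t|` for `|t| ≤ 1/2`, of which
only `|t|` is kept. -/
lemma norm_le_norm_fourier_one_sub_one (x : UnitAddCircle) :
    ‖x‖ ≤ ‖(fourier 1 x : ℂ) - 1‖ := by
  induction x using QuotientAddGroup.induction_on with
  | H t =>
  set s : ℝ := t - round t with hs
  have hst : (t : UnitAddCircle) = (s : UnitAddCircle) := by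
    rw [hs, AddCircle.coe_sub, eq_comm, sub_eq_self]
    have := AddCircle.coe_eq_zero_iff (p := (1 : ℝ)) (x := (round t : ℝ))
    exact this.2 ⟨round t, by simp⟩
  have habs : |s| ≤ 1 / 2 := abs_sub_round t
  change ‖((t : ℝ) : UnitAddCircle)‖ ≤ ‖fourier 1 ((t : ℝ) : UnitAddCircle) - 1‖
  rw [hst, fourier_coe_apply]
  have e1 : (2 * Real.pi * Complex.I * (1 : ℤ) * s / (1 : ℝ) : ℂ) =
      Complex.I * ((2 * Real.pi * s : ℝ) : ℂ) := by push_cast; ring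
  rw [e1, Complex.norm_exp_I_mul_ofReal_sub_one]
  have e2 : ‖(s : UnitAddCircle)‖ ≤ |s| := by
    rw [AddCircle.norm_eq]
    simpa using round_le s 0
  refine e2.trans ?_
  have e3 := Real.mul_abs_le_abs_sin (x := Real.pi * s) (by
    rw [abs_mul, abs_of_pos Real.pi_pos]; nlinarith [Real.pi_pos])
  rw [abs_mul, abs_of_pos Real.pi_pos] at e3
  rw [norm_mul, Real.norm_eq_abs, Real.norm_eq_abs, abs_two,
    show 2 * Real.pi * s / 2 = Real.pi * s by ring]
  have e4 : 2 / Real.pi * (Real.pi * |s|) = 2 * |s| := by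
    field_simp
  rw [e4] at e3
  linarith [abs_nonneg s]

/-- The character of frequency `k` as an additive homomorphism `x ↦ ∑ i, k i • x i` to `ℝ/ℤ`. -/
noncomputable def torusCharacter {d : ℕ} (k : Fin d → ℤ) :
    UnitAddTorus (Fin d) →+ UnitAddCircle where
  toFun x := ∑ i, k i • x i
  map_zero' := by simp
  map_add' x y := by simp [Finset.sum_add_distrib]

lemma mFourier_eq_fourier_torusCharacter {d : ℕ} (k : Fin d → ℤ) (x : UnitAddTorus (Fin d)) :
    UnitAddTorus.mFourier k x = fourier 1 (torusCharacter k x) := by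
  have h : ∀ s : Finset (Fin d),
      ∏ i ∈ s, (fourier (k i) (x i) : ℂ) = fourier 1 (∑ i ∈ s, k i • x i) := by
    intro s
    induction s using Finset.cons_induction with
    | empty => simp
    | cons i s hi ih =>
      rw [Finset.prod_cons, Finset.sum_cons, ih]
      simp [fourier_apply, AddCircle.toCircle_add]
  exact h Finset.univ

/-- A nonzero character is onto, hence carries the Haar probability of the torus to that of the
circle. -/
lemma measurePreserving_torusCharacter {d : ℕ} {k : Fin d → ℤ} (hk : k ≠ 0) :
    MeasurePreserving (torusCharacter k) volume volume := by
  apply AddMonoidHom.measurePreserving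
  · change Continuous fun x : UnitAddTorus (Fin d) => ∑ i, k i • x i
    fun_prop
  · intro y
    obtain ⟨i, hi⟩ := Function.ne_iff.1 hk
    induction y using QuotientAddGroup.induction_on with
    | H t =>
    refine ⟨Pi.single i ((t / k i : ℝ) : UnitAddCircle), ?_⟩
    change ∑ j, k j • (Pi.single i ((t / k i : ℝ) : UnitAddCircle) : Fin d → UnitAddCircle) j = _
    rw [Finset.sum_eq_single i (fun j _ hj => by simp [hj]) (by simp), Pi.single_eq_same,
      ← AddCircle.coe_zsmul]
    congr 1
    have : (k i : ℝ) ≠ 0 := by exact_mod_cast hi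
    rw [zsmul_eq_mul]
    field_simp
  · simp [UnitAddTorus, volume_pi, Measure.pi_univ]

lemma volume_norm_mFourier_sub_one_le {d : ℕ} {k : Fin d → ℤ} (hk : k ≠ 0) (δ : ℝ) :
    volume {ρ : UnitAddTorus (Fin d) | ‖UnitAddTorus.mFourier k ρ - 1‖ ≤ δ} ≤
      ENNReal.ofReal (2 * δ) := by
  calc volume {ρ : UnitAddTorus (Fin d) | ‖UnitAddTorus.mFourier k ρ - 1‖ ≤ δ}
      ≤ volume (torusCharacter k ⁻¹' Metric.closedBall 0 δ) := by
        refine measure_mono fun ρ hρ => ?_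
        simp only [Set.mem_ofPred_eq, mFourier_eq_fourier_torusCharacter] at hρ
        simpa using (norm_le_norm_fourier_one_sub_one _).trans hρ
    _ = volume (Metric.closedBall (0 : UnitAddCircle) δ) :=
        (measurePreserving_torusCharacter hk).measure_preimage
          Metric.isClosed_closedBall.measurableSet.nullMeasurableSet
    _ ≤ ENNReal.ofReal (2 * δ) := by
        rw [AddCircle.volume_closedBall]
        exact ENNReal.ofReal_le_ofReal (min_le_right _ _)

/-- Almost every rotation vector is Diophantine: by Borel-Cantelli only finitely many frequencies
violate `smallDivisorBound`, and those are absorbed in the constant since almost every rotation has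
no resonance. -/
lemma ae_exists_diophantine (d : ℕ) :
    ∀ᵐ ρ : UnitAddTorus (Fin d), ∃ γ : ℝ, 0 < γ ∧ ∀ k : Fin d → ℤ, k ≠ 0 →
      γ * (freqNorm k ^ (2 * d))⁻¹ ≤ ‖UnitAddTorus.mFourier k ρ - 1‖ := by
  have h1 : ∀ᵐ ρ : UnitAddTorus (Fin d), ∀ k : Fin d → ℤ, k ≠ 0 →
      0 < ‖UnitAddTorus.mFourier k ρ - 1‖ := by
    rw [ae_all_iff]
    intro k
    by_cases hk : k = 0
    · simp [hk]
    · have := volume_norm_mFourier_sub_one_le hk 0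
      simp only [mul_zero, ENNReal.ofReal_zero, nonpos_iff_eq_zero] at this
      filter_upwards [measure_eq_zero_iff_ae_notMem.1 this] with ρ hρ _
      simpa only [Set.mem_ofPred_eq, not_le] using hρ
  set s : (Fin d → ℤ) → Set (UnitAddTorus (Fin d)) := fun k =>
    {ρ | k ≠ 0 ∧ ‖UnitAddTorus.mFourier k ρ - 1‖ ≤ smallDivisorBound k} with hs
  have hsum : ∑' k, volume (s k) ≠ ⊤ := by
    refine ne_top_of_le_ne_top ((summable_smallDivisorBound d).mul_left 2).tsum_ofReal_ne_top
      (ENNReal.tsum_le_tsum fun k => ?_)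
    by_cases hk : k = 0
    · simp [hs, hk]
    · exact (measure_mono fun ρ hρ => hρ.2).trans (volume_norm_mFourier_sub_one_le hk _)
  filter_upwards [h1, ae_finite_setOfPred_mem hsum] with ρ h1 h2
  obtain ⟨M, hM⟩ := (h2.image fun k => ‖UnitAddTorus.mFourier k ρ - 1‖⁻¹).bddAbove
  have hM1 : 0 < max M 1 := by positivity
  refine ⟨min (((2 : ℝ) ^ (2 * d))⁻¹) (max M 1)⁻¹, by positivity, fun k hk => ?_⟩
  have hf := one_le_freqNorm hk
  by_cases hks : ρ ∈ s k
  · have h3 : ‖UnitAddTorus.mFourier k ρ - 1‖⁻¹ ≤ max M 1 :=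
      (hM (Set.mem_image_of_mem _ hks)).trans (le_max_left _ _)
    calc _ ≤ (max M 1)⁻¹ * 1 := by
          gcongr
          · exact min_le_right _ _
          · exact inv_le_one_of_one_le₀ (one_le_pow₀ hf)
      _ ≤ _ := by
          rw [mul_one]
          exact inv_le_of_inv_le₀ (h1 k hk) h3
  · have h3 : smallDivisorBound k ≤ ‖UnitAddTorus.mFourier k ρ - 1‖ := by
      by_contra hc
      exact hks ⟨hk, (not_le.1 hc).le⟩
    refine le_trans ?_ ((le_smallDivisorBound hk).trans h3)
    rw [mul_pow, mul_inv]
    gcongr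
    exact min_le_left _ _

/-! ### Fourier expansion and decay of the error -/

lemma mFourierCoeff_zero_eq_integral {d : ℕ} (f : UnitAddTorus (Fin d) → ℂ) :
    UnitAddTorus.mFourierCoeff f 0 = ∫ x, f x := by
  -- Mathlib normalises the circle by its Haar measure, which is the length measure for period one.
  have hvol : (AddCircle.haarAddCircle : Measure UnitAddCircle) = volume := by
    rw [AddCircle.volume_eq_smul_haarAddCircle, ENNReal.ofReal_one, one_smul]
  have h : UnitAddTorus.mFourierCoeff f 0 =
      ∫ x, UnitAddTorus.mFourier (-0) x • f x
        ∂(Measure.pi fun _ : Fin d => (AddCircle.haarAddCircle : Measure UnitAddCircle)) := rfl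
  rw [h, hvol]
  simp only [neg_zero, UnitAddTorus.mFourier_zero, ContinuousMap.one_apply, one_smul]
  rfl

lemma torusRotation_iterate {d : ℕ} (ρ θ : UnitAddTorus (Fin d)) (n : ℕ) :
    (torusRotation ρ)^[n] θ = θ + n • ρ := by
  induction n with
  | zero => simp
  | succ n ih => rw [Function.iterate_succ_apply', ih, torusRotation, succ_nsmul, add_assoc]

lemma mFourier_add_nsmul {d : ℕ} (k : Fin d → ℤ) (θ ρ : UnitAddTorus (Fin d)) (n : ℕ) :
    UnitAddTorus.mFourier k (θ + n • ρ) =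
      UnitAddTorus.mFourier k θ * UnitAddTorus.mFourier k ρ ^ n := by
  simp only [mFourier_eq_fourier_torusCharacter, map_add, map_nsmul, fourier_one,
    AddCircle.toCircle_add, AddCircle.toCircle_nsmul, Circle.coe_mul, Circle.coe_pow]

lemma norm_mFourier_apply {d : ℕ} (k : Fin d → ℤ) (x : UnitAddTorus (Fin d)) :
    ‖UnitAddTorus.mFourier k x‖ = 1 := by
  rw [mFourier_eq_fourier_torusCharacter, fourier_apply, Circle.norm_coe]

/-- Expanding `f` in its Fourier series turns the error into a series of Fourier coefficients times
normalised exponential sums over the nonzero frequencies. -/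
lemma birkhoffError_le_tsum {d : ℕ} {p q : ℝ} {f : UnitAddTorus (Fin d) → ℂ} (hf : Continuous f)
    (hsum : Summable (UnitAddTorus.mFourierCoeff f)) {ρ θ : UnitAddTorus (Fin d)} {N : ℕ}
    (hA : weightSum p q N ≠ 0) {b : (Fin d → ℤ) → ℝ} (hb : Summable b) (hb0 : 0 ≤ b 0)
    (hbk : ∀ k, k ≠ 0 → ‖UnitAddTorus.mFourierCoeff f k‖ *
      ‖((weightSum p q N)⁻¹ : ℂ) * ∑ n ∈ Finset.range N,
        (expWeight p q ((n : ℝ) / N) : ℂ) * UnitAddTorus.mFourier k ρ ^ n‖ ≤ b k) :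
    birkhoffError p q f ρ θ N ≤ ∑' k, b k := by
  classical
  set c := UnitAddTorus.mFourierCoeff f with hc
  set S : (Fin d → ℤ) → ℂ := fun k => ((weightSum p q N)⁻¹ : ℂ) * ∑ n ∈ Finset.range N,
        (expWeight p q ((n : ℝ) / N) : ℂ) * UnitAddTorus.mFourier k ρ ^ n with hS
  have hS0 : S 0 = 1 := by
    simp only [hS, UnitAddTorus.mFourier_zero, ContinuousMap.one_apply, one_pow, mul_one]
    rw [← Complex.ofReal_sum]
    exact inv_mul_cancel₀ (by exact_mod_cast hA)
  have hpt : ∀ x, HasSum (fun k => c k * UnitAddTorus.mFourier k x) (f x) := fun x => by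
    simpa using UnitAddTorus.hasSum_mFourier_series_apply_of_summable
      (f := ⟨f, hf⟩) hsum x
  have havg : HasSum (fun k => c k * (UnitAddTorus.mFourier k θ * S k))
      (weightedBirkhoffAverage p q f ρ θ N) := by
    have h1 := (hasSum_sum (s := Finset.range N) fun n _ =>
      (hpt ((torusRotation ρ)^[n] θ)).mul_left (expWeight p q ((n : ℝ) / N) : ℂ)).mul_left
        ((weightSum p q N)⁻¹ : ℂ)
    have h2 : weightedBirkhoffAverage p q f ρ θ N = ((weightSum p q N)⁻¹ : ℂ) *
        ∑ n ∈ Finset.range N, (expWeight p q ((n : ℝ) / N) : ℂ) * f ((torusRotation ρ)^[n] θ) := by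
      simp only [weightedBirkhoffAverage, Complex.real_smul]
      push_cast
      rfl
    rw [h2]
    refine h1.congr_fun fun k => ?_
    simp only [hS, torusRotation_iterate, mFourier_add_nsmul, Finset.mul_sum]
    refine Finset.sum_congr rfl fun n _ => ?_
    ring
  have hint : HasSum (fun k : Fin d → ℤ => if k = 0 then c 0 else 0) (∫ x, f x) := by
    rw [← mFourierCoeff_zero_eq_integral]
    exact hasSum_ite_eq 0 _
  have hdiff := havg.sub hint
  rw [birkhoffError, ← hdiff.tsum_eq]
  refine tsum_of_norm_bounded hb.hasSum fun k => ?_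
  by_cases hk : k = 0
  · subst hk
    simpa [hS0, UnitAddTorus.mFourier_zero] using hb0
  · rw [if_neg hk, sub_zero, norm_mul, norm_mul, norm_mFourier_apply, one_mul]
    exact hbk k hk

/-- Choice of the order of summation by parts: with `m = ⌈N^a⌉` and small divisors no smaller than a
small negative power of `N`, the bound on the exponential sums is at most `exp (-N^a)`. -/
lemma exists_order_bound_le_exp {a P B K γ : ℝ} (ha : 0 < a) (ha1 : a < 1) (hP : 2 ≤ P)
    (hPa : 2 / (1 - a) ≤ P) (hB : 0 < B) (hK : 0 < K) (hγ : 0 < γ) :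
    ∀ᶠ N : ℕ in Filter.atTop, ∀ y : ℝ, γ * (N : ℝ) ^ (-((1 - a) / 4)) ≤ y →
      B * (N + ⌈(N : ℝ) ^ a⌉₊) *
        (K * (⌈(N : ℝ) ^ a⌉₊ : ℝ) ^ (1 + 1 / P) / (N * y)) ^ ⌈(N : ℝ) ^ a⌉₊ ≤
      Real.exp (-(N : ℝ) ^ a) := by
  have h1a : 0 < 1 - a := by linarith
  have hP1 : 1 / P ≤ (1 - a) / 2 := by
    rw [div_le_div_iff₀ (by linarith) (by norm_num)]
    rw [div_le_iff₀ h1a] at hPa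
    linarith
  have hNat : Filter.Tendsto (fun N : ℕ => (N : ℝ)) Filter.atTop Filter.atTop :=
    tendsto_natCast_atTop_atTop
  have ht1 : Filter.Tendsto (fun N : ℕ => 4 * K / γ * (N : ℝ) ^ (-((1 - a) / 4))) Filter.atTop
      (nhds 0) := by
    simpa using ((tendsto_rpow_neg_atTop (by positivity : 0 < (1 - a) / 4)).comp hNat).const_mul
      (4 * K / γ)
  have ht2 : Filter.Tendsto (fun N : ℕ => 3 * B * ((N : ℝ) * Real.exp (-(N : ℝ) ^ a)))
      Filter.atTop (nhds 0) := by
    have h := ((tendsto_rpow_mul_exp_neg_mul_atTop_nhds_zero (1 / a) 1 one_pos).comp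
      ((tendsto_rpow_atTop ha).comp hNat)).const_mul (3 * B)
    rw [mul_zero] at h
    refine h.congr fun N => ?_
    simp only [Function.comp_apply, neg_mul, one_mul]
    rw [← Real.rpow_mul (by positivity), mul_one_div_cancel ha.ne', Real.rpow_one]
  -- A ratio `exp (-2)` gives `exp (-2 N^a)`; half of it absorbs the number `N + m` of terms.
  filter_upwards [ht1.eventually (ge_mem_nhds (Real.exp_pos (-2))),
    ht2.eventually (ge_mem_nhds one_pos), Filter.eventually_ge_atTop 1] with N hN1 hN2 hN y hy
  have hNr : (1 : ℝ) ≤ N := by exact_mod_cast hN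
  have hN0 : (0 : ℝ) < N := by linarith
  set X : ℝ := (N : ℝ) ^ a with hX
  have hX1 : 1 ≤ X := Real.one_le_rpow hNr ha.le
  have hXN : X ≤ N := by
    simpa using Real.rpow_le_rpow_of_exponent_le hNr ha1.le
  set m := ⌈X⌉₊ with hm
  have hm1 : X ≤ m := Nat.le_ceil X
  have hm2 : (m : ℝ) ≤ 2 * X := by linarith [Nat.ceil_lt_add_one (by linarith : 0 ≤ X)]
  have hσ : 1 + 1 / P ≤ 2 := by
    have : 1 / P ≤ 1 := by
      rw [div_le_one (by linarith)]
      linarith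
    linarith
  have hσ0 : 0 < 1 + 1 / P := by positivity
  have hmσ : (m : ℝ) ^ (1 + 1 / P) ≤ 4 * (N : ℝ) ^ (a + (1 - a) / 2) := by
    calc (m : ℝ) ^ (1 + 1 / P) ≤ (2 * X) ^ (1 + 1 / P) := by gcongr
      _ = 2 ^ (1 + 1 / P) * X ^ (1 + 1 / P) := Real.mul_rpow (by norm_num) (by linarith)
      _ ≤ 2 ^ (2 : ℝ) * (N : ℝ) ^ (a + (1 - a) / 2) := by
          gcongr
          · norm_num
          · rw [hX, ← Real.rpow_mul hN0.le]
            apply Real.rpow_le_rpow_of_exponent_le hNr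
            have : a * (1 / P) ≤ 1 * ((1 - a) / 2) :=
              mul_le_mul ha1.le hP1 (by positivity) zero_le_one
            linarith
      _ = _ := by norm_num
  have hy0 : 0 < γ * (N : ℝ) ^ (-((1 - a) / 4)) := by positivity
  have hratio : K * (m : ℝ) ^ (1 + 1 / P) / (N * y) ≤ Real.exp (-2) := by
    refine le_trans ?_ hN1
    calc K * (m : ℝ) ^ (1 + 1 / P) / (N * y)
        ≤ K * (4 * (N : ℝ) ^ (a + (1 - a) / 2)) / (N * (γ * (N : ℝ) ^ (-((1 - a) / 4)))) := by
          gcongr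
      _ = 4 * K / γ * ((N : ℝ) ^ (a + (1 - a) / 2) / (N ^ (1 : ℝ) * (N : ℝ) ^ (-((1 - a) / 4)))) := by
          rw [Real.rpow_one]
          field_simp
      _ = _ := by
          rw [← Real.rpow_add hN0, ← Real.rpow_sub hN0]
          congr 2
          ring
  have hratio0 : 0 ≤ K * (m : ℝ) ^ (1 + 1 / P) / (N * y) := by
    have : 0 < y := hy0.trans_le hy
    positivity
  calc B * (N + m) * (K * (m : ℝ) ^ (1 + 1 / P) / (N * y)) ^ m
      ≤ B * (3 * N) * Real.exp (-2) ^ m := by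
        gcongr
        linarith
    _ ≤ B * (3 * N) * Real.exp (-X + -X) := by
        rw [← Real.exp_nat_mul]
        gcongr
        linarith
    _ = (3 * B * (N * Real.exp (-X))) * Real.exp (-X) := by
        rw [Real.exp_add]
        ring
    _ ≤ 1 * Real.exp (-X) := by gcongr
    _ = _ := one_mul _

/-- Super-analyticity in the form used for the truncation at `|k| = N^ε`: the coefficients decay
exponentially, and those beyond the truncation are also at most `exp (-N)`. -/
lemma IsSuperAnalytic.exists_coeff_le {d : ℕ} {f : UnitAddTorus (Fin d) → ℂ}
    (hf : IsSuperAnalytic f) {ε : ℝ} (hε : 0 < ε) (hε1 : ε < 1) :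
    ∃ C : ℝ, 0 < C ∧
      (∀ k, ‖UnitAddTorus.mFourierCoeff f k‖ ≤ C * Real.exp (-freqNorm k)) ∧
      ∀ N : ℕ, 1 ≤ N → ∀ k, (N : ℝ) ^ ε ≤ freqNorm k →
        ‖UnitAddTorus.mFourierCoeff f k‖ ≤ C * Real.exp (-N) * Real.exp (-freqNorm k) := by
  have hv : 1 < 1 / ε := by rwa [lt_div_iff₀ hε, one_mul]
  obtain ⟨C, hC⟩ := hf (1 / ε * 2) (by linarith)
  have hC0 : 0 < max C 1 := by positivity
  have hC' : ∀ k, ‖UnitAddTorus.mFourierCoeff f k‖ ≤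
      max C 1 * Real.exp (-(freqNorm k ^ (1 / ε * 2))) := fun k =>
    (hC k).trans (by gcongr; exact le_max_left _ _)
  refine ⟨max C 1 * Real.exp 1, by positivity, fun k => ?_, fun N hN k hk => ?_⟩
  · refine (hC' k).trans ?_
    rw [mul_assoc, ← Real.exp_add]
    gcongr
    rcases le_or_gt (freqNorm k) 1 with h | h
    · have : 0 ≤ freqNorm k ^ (1 / ε * 2) := Real.rpow_nonneg (freqNorm_nonneg k) _
      linarith
    · have := Real.rpow_le_rpow_of_exponent_le h.le (by linarith : 1 ≤ 1 / ε * 2)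
      rw [Real.rpow_one] at this
      linarith
  · refine (hC' k).trans ?_
    rw [mul_assoc, mul_assoc, ← Real.exp_add, ← Real.exp_add]
    gcongr
    have hNr : (1 : ℝ) ≤ N := by exact_mod_cast hN
    have hk1 : 1 ≤ freqNorm k := (Real.one_le_rpow hNr hε.le).trans hk
    -- Half of the exponent pays for `exp (-N)`, the other half for `exp (-|k|)`.
    set y := freqNorm k ^ (1 / ε) with hy
    have hyk : freqNorm k ≤ y := by
      simpa [hy] using Real.rpow_le_rpow_of_exponent_le hk1 hv.le
    have hyN : (N : ℝ) ≤ y := by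
      have := Real.rpow_le_rpow (by positivity) hk (by positivity : 0 ≤ 1 / ε)
      rwa [← Real.rpow_mul (by positivity), mul_one_div_cancel hε.ne', Real.rpow_one] at this
    have hsq : freqNorm k ^ (1 / ε * 2) = y * y := by
      rw [Real.rpow_mul (by linarith), Real.rpow_two, sq]
    rw [hsq]
    nlinarith [mul_le_mul hyN hyk (by linarith) (by linarith),
      mul_nonneg (sub_nonneg.2 hNr) (sub_nonneg.2 hk1)]

theorem theorem6p2 :
    ∃ c : ℝ, 0 < c ∧
      ∀ (d : ℕ), 1 ≤ d →
      ∀ f : UnitAddTorus (Fin d) → ℂ, Continuous f → IsSuperAnalytic f →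
      ∀ a : ℝ, 0 < a → a < 1 →
      ∀ᵐ ρ : UnitAddTorus (Fin d),
      ∃ P : ℝ, 1 ≤ P ∧ ∀ p q : ℝ, P ≤ p → P ≤ q →
      ∃ C : ℝ, ∀ N : ℕ, 2 ≤ N → ∀ θ : UnitAddTorus (Fin d),
        birkhoffError p q f ρ θ N ≤ C * Real.exp (-(c * (N : ℝ) ^ a)) := by
  refine ⟨1, one_pos, fun d hd f hf hsa a ha ha1 => ?_⟩
  simp only [one_mul]
  have hd' : (1 : ℝ) ≤ d := by exact_mod_cast hd
  have h1a : 0 < 1 - a := by linarith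
  -- With `|k| ≤ N^ε` the small divisors `|k|^(-2d)` stay above `N^(-(1-a)/4)`.
  set ε : ℝ := (1 - a) / 4 / (2 * d) with hε
  have hε0 : 0 < ε := by positivity
  have hε1 : ε < 1 := by
    rw [hε, div_lt_one (by positivity)]
    linarith
  obtain ⟨M, hM0, hM1, hM2⟩ := hsa.exists_coeff_le hε0 hε1
  have hsumE := summable_exp_neg_freqNorm d
  have hsum : Summable (UnitAddTorus.mFourierCoeff f) :=
    Summable.of_norm_bounded (hsumE.mul_left M) hM1
  filter_upwards [ae_exists_diophantine d] with ρ hρ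
  obtain ⟨γ, hγ, hργ⟩ := hρ
  refine ⟨max 2 (2 / (1 - a)), one_le_two.trans (le_max_left _ _), fun p q hp hq => ?_⟩
  obtain ⟨B, K, hB, hK, hS⟩ := exists_norm_weighted_sum_le (le_max_left _ _) hp hq
  have hp2 : 2 ≤ p := (le_max_left _ _).trans hp
  have hq2 : 2 ≤ q := (le_max_left _ _).trans hq
  obtain ⟨A, hA0, hA⟩ := exists_weightSum_ge (p := p) (q := q) (by linarith) (by linarith)
  have hA' : ∀ N : ℕ, 2 ≤ N → weightSum p q N ≠ 0 := fun N hN => (hA0.trans_le (hA N hN)).ne'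
  obtain ⟨N₀, hN₀⟩ := Filter.eventually_atTop.1 (exists_order_bound_le_exp ha ha1
    (le_max_left _ _) (le_max_right _ _) hB hK hγ)
  -- The asymptotic bound needs `N ≥ N₀`; for smaller `N` the error is bounded, and the constant is
  -- enlarged by `exp (N₀^a)`.
  set E := ∑' k : Fin d → ℤ, Real.exp (-freqNorm k) with hE
  have hE0 : 0 ≤ E := tsum_nonneg fun k => (Real.exp_pos _).le
  have hlarge : ∀ N : ℕ, 2 ≤ N → N₀ ≤ N → ∀ θ : UnitAddTorus (Fin d),
      birkhoffError p q f ρ θ N ≤ M * E * Real.exp (-(N : ℝ) ^ a) := by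
    intro N hN hNN θ
    have hNr : (1 : ℝ) ≤ N := by exact_mod_cast (by omega : 1 ≤ N)
    have h := birkhoffError_le_tsum (θ := θ) (ρ := ρ) hf hsum (hA' N hN)
      (hsumE.mul_left (M * Real.exp (-(N : ℝ) ^ a))) (by positivity) ?_
    · rw [tsum_mul_left] at h
      linarith
    intro k hk
    have hk1 := one_le_freqNorm hk
    rcases le_or_gt (freqNorm k) ((N : ℝ) ^ ε) with hkN | hkN
    · have hdiv : γ * (N : ℝ) ^ (-((1 - a) / 4)) ≤ ‖UnitAddTorus.mFourier k ρ - 1‖ := by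
        refine le_trans ?_ (hργ k hk)
        rw [Real.rpow_neg (by positivity)]
        gcongr
        calc freqNorm k ^ (2 * d) ≤ ((N : ℝ) ^ ε) ^ (2 * d) := by gcongr
          _ = (N : ℝ) ^ ((1 - a) / 4) := by
            rw [← Real.rpow_mul_natCast (by positivity), hε]
            congr 1
            push_cast
            field_simp
      have hne : UnitAddTorus.mFourier k ρ ≠ 1 := by
        intro h1
        rw [h1, sub_self, norm_zero] at hdiv
        have : 0 < γ * (N : ℝ) ^ (-((1 - a) / 4)) := by positivity
        linarith
      have h1 := (hS N hN ⌈(N : ℝ) ^ a⌉₊ _ (norm_mFourier_apply k ρ) hne).trans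
        (hN₀ N hNN _ hdiv)
      calc _ ≤ M * Real.exp (-freqNorm k) * Real.exp (-(N : ℝ) ^ a) :=
            mul_le_mul (hM1 k) h1 (norm_nonneg _) (by positivity)
        _ = _ := by ring
    · have hXN : (N : ℝ) ^ a ≤ N := by
        simpa using Real.rpow_le_rpow_of_exponent_le hNr ha1.le
      calc _ ≤ M * Real.exp (-N) * Real.exp (-freqNorm k) * 1 :=
            mul_le_mul (hM2 N (by omega) k hkN.le)
              (norm_weighted_sum_le_one p q N (norm_mFourier_apply k ρ)) (norm_nonneg _)
              (by positivity)
        _ ≤ _ := by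
            rw [mul_one]
            gcongr
  have hsmall : ∀ N : ℕ, 2 ≤ N → ∀ θ : UnitAddTorus (Fin d),
      birkhoffError p q f ρ θ N ≤ M * E := by
    intro N hN θ
    have h := birkhoffError_le_tsum (θ := θ) (ρ := ρ) hf hsum (hA' N hN)
      (hsumE.mul_left M) (by positivity) fun k hk => ?_
    · rwa [tsum_mul_left] at h
    · calc _ ≤ M * Real.exp (-freqNorm k) * 1 :=
            mul_le_mul (hM1 k) (norm_weighted_sum_le_one p q N (norm_mFourier_apply k ρ))
              (norm_nonneg _) (by positivity)
        _ = _ := mul_one _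
  refine ⟨M * E * Real.exp ((N₀ : ℝ) ^ a), fun N hN θ => ?_⟩
  rcases le_or_gt N₀ N with hNN | hNN
  · refine (hlarge N hN hNN θ).trans ?_
    exact mul_le_mul_of_nonneg_right
      (le_mul_of_one_le_right (by positivity) (Real.one_le_exp (by positivity))) (by positivity)
  · refine (hsmall N hN θ).trans ?_
    rw [mul_assoc, ← Real.exp_add]
    refine le_mul_of_one_le_right (by positivity) (Real.one_le_exp ?_)
    have : (N : ℝ) ^ a ≤ (N₀ : ℝ) ^ a := by gcongr
    linarith
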